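/- **Theorem 1.1.** For an integer $n\ge 2$, the $n$-adic intervals are the intervals $[k n^{-j},(k+1)n^{-j})$ with $j,k\in\mathbb Z$; two of them are siblings if they are among the $n$ intervals of generation $j+1$ contained in the same $n$-adic interval of generation $j$. A Borel measure $\mu$ on $\mathbb R$ is $n$-adic doubling if there is a constant $C$ with $\mu(J)\le C\,\mu(J')$ for all siblings $J,J'$, and it is doubling if there is a constant $C$ with $\mu(2I)\le C\,\mu(I)$ for every bounded open interval $I$, where $2I$ is the interval with the same centre and twice the length. Let $m,n\ge 2$ be coprime integers. Then there is an infinite family of Borel measures on $\mathbb R$, no two of which are constant multiples of each other, such that every $\mu$ in the family satisfies $0<\mu(I)<\infty$ for every nonempty bounded open interval $I$, is both $m$-adic doubling and $n$-adic doubling, and is not doubling. Moreover, no $\mu$ in the family satisfies $\mu(2I)\le C\,\mu(I)$ with a uniform constant $C$ even when only those intervals $I$ are considered for which $2I$ contains no integer. -/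

import Mathlib

open MeasureTheory Set
open scoped NNReal ENNReal

/-- The doubling condition, tested on the open intervals `I` whose double `2I` (same centre, twice
the length) lies in `s`: there is a constant `C` with `μ (2I) ≤ C * μ I` for all those `I`. -/
def IsDoublingOn (μ : Measure ℝ) (s : Set ℝ) : Prop :=
  ∃ C : ℝ≥0, ∀ x r : ℝ, 0 < r → Metric.ball x (2 * r) ⊆ s →
    μ (Metric.ball x (2 * r)) ≤ (C : ℝ≥0∞) * μ (Metric.ball x r)

/-- A doubling measure on the line: `μ (2I) ≤ C * μ I` for every bounded open interval `I`. -/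
def IsDoubling (μ : Measure ℝ) : Prop :=
  IsDoublingOn μ Set.univ

/-- The `n`-adic interval `[k / n ^ j, (k + 1) / n ^ j)`, of any generation `j : ℤ`. -/
def nadicInterval (n : ℕ) (j k : ℤ) : Set ℝ :=
  Set.Ico ((k : ℝ) / (n : ℝ) ^ j) (((k : ℝ) + 1) / (n : ℝ) ^ j)

/-- `n`-adic doubling: the masses of any two siblings, that is, of two of the `n` children
`nadicInterval n (j + 1) (n * k + i)`, `i = 0, …, n - 1`, of one `n`-adic interval
`nadicInterval n j k`, are comparable, with a constant that does not depend on the siblings. -/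
def IsNadicDoubling (n : ℕ) (μ : Measure ℝ) : Prop :=
  ∃ C : ℝ≥0, ∀ j k : ℤ, ∀ i i' : Fin n,
    μ (nadicInterval n (j + 1) ((n : ℤ) * k + ((i : ℕ) : ℤ))) ≤
      (C : ℝ≥0∞) * μ (nadicInterval n (j + 1) ((n : ℤ) * k + ((i' : ℕ) : ℤ)))

/-!
The density is `1` except for one *dip* in each unit interval `[I, I + 1)` with `I` large, and the
dip of generation `i` is invisible to both grids. Suppose `m < n`. As `m ^ i` and `n ^ i` are
coprime, there are points `p = k / m ^ i` and `q = l / n ^ i` with `p - q = δ = (m * n) ^ (-i)`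
(`exists_mul_pow_sub_mul_pow_eq_one`), far below the grid scale `R = n ^ (-i)`. To the left of `p`
the density is `1`; to the right it is the square root of `dip δ R (x - q)`, which falls from `1`
at distance `δ` from `q` to a value tending to `0` with `i`, and recovers to `1` at distance `R`.

* To the right of `q` the dip lies between the powers `1 / 2` and `-1 / 2` of the distance to `q`,
  so that it is a doubling weight there, uniformly in `i` (`setLIntegral_sqrt_dip_le`).
* An `m`-adic interval of length less than `m ^ (-i)` does not cross `p`, and an `n`-adic interval
  of length less than `n ^ (-i)` does not cross `q`. So siblings lie in a region where the density
  is `1`, or both lie to the right of `q`. Longer intervals have length at least `R`, and the dip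
  leaves a fixed proportion of their mass (`le_setLIntegral_sqrt_dip`). This gives both adic
  doubling conditions (`isNadicDoubling_dipMeasure`).
* An interval `I` that starts at `q`, of length between `δ` and `R`, has small density on most of
  it, while its double has density `1` on a quarter of its length, to the left of `q`. So doubling
  fails, within single unit intervals (`not_isDoublingOn_dipMeasure`).

Letting the dips start only after the integer `N`, for `N = 0, 1, 2, …`, gives an infinite family.
-/

/-! ### The dip profile -/

/-- The profile of a dip of outer scale `R` and inner scale `δ ≤ R`: it equals `1` for `t ≤ δ` and for
`t ≥ R`, and in between it is the larger of `t / R` and `δ / t`, with minimum `√(δ / R)`. -/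
noncomputable def dip (δ R t : ℝ) : ℝ := min 1 (max (t / R) (δ / max t δ))

lemma dip_le_one (δ R t : ℝ) : dip δ R t ≤ 1 := min_le_left _ _

lemma dip_pos {δ : ℝ} (hδ : 0 < δ) (R t : ℝ) : 0 < dip δ R t :=
  lt_min one_pos (lt_max_of_lt_right (div_pos hδ (lt_max_of_lt_right hδ)))

lemma dip_eq_one {δ R t : ℝ} (hδ : 0 < δ) (ht : t ≤ δ) : dip δ R t = 1 := by
  rw [dip, max_eq_right ht, div_self hδ.ne']
  exact min_eq_left (le_max_right _ _)

lemma min_one_div_le_dip (δ R t : ℝ) : min 1 (t / R) ≤ dip δ R t :=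
  min_le_min_left _ (le_max_left _ _)

/-- `t * dip δ R t` is nondecreasing in `t > 0`. -/
lemma mul_dip_le_mul_dip {δ R s t : ℝ} (hδ : 0 < δ) (hR : 0 < R) (hs : 0 < s) (hst : s ≤ t) :
    s * dip δ R s ≤ t * dip δ R t := by
  have ht : 0 < t := hs.trans_le hst
  unfold dip
  rw [mul_min_of_nonneg _ _ hs.le, mul_max_of_nonneg _ _ hs.le, mul_min_of_nonneg _ _ ht.le,
    mul_max_of_nonneg _ _ ht.le]
  refine min_le_min (by linarith) (max_le_max (by gcongr) ?_)
  have h1 : 0 < max s δ := lt_max_of_lt_right hδ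
  have h2 : 0 < max t δ := lt_max_of_lt_right hδ
  rw [← mul_div_assoc, ← mul_div_assoc, div_le_div_iff₀ h1 h2]
  have h3 : s * max t δ ≤ t * max s δ := by
    rw [mul_max_of_nonneg _ _ hs.le, mul_max_of_nonneg _ _ ht.le, mul_comm s t]
    exact max_le_max le_rfl (by gcongr)
  calc s * δ * max t δ = δ * (s * max t δ) := by ring
    _ ≤ δ * (t * max s δ) := by gcongr
    _ = _ := by ring

/-- `dip δ R t / t` is nonincreasing in `t > 0`. -/
lemma dip_mul_le_dip_mul {δ R s t : ℝ} (hδ : 0 < δ) (hs : 0 < s) (hst : s ≤ t) :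
    dip δ R t * s ≤ dip δ R s * t := by
  have ht : 0 < t := hs.trans_le hst
  unfold dip
  rw [min_mul_of_nonneg _ _ hs.le, max_mul_of_nonneg _ _ hs.le, min_mul_of_nonneg _ _ ht.le,
    max_mul_of_nonneg _ _ ht.le]
  refine min_le_min (by linarith) (max_le_max (le_of_eq (by ring)) ?_)
  have h1 : 0 < max s δ := lt_max_of_lt_right hδ
  gcongr

/-! ### Integrals of the square root of a dip -/

lemma setLIntegral_ofReal_le {f : ℝ → ℝ} {a L B : ℝ} (hB : 0 ≤ B)
    (h : ∀ x ∈ Ico a (a + L), f x ≤ B) :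
    ∫⁻ x in Ico a (a + L), ENNReal.ofReal (f x) ≤ ENNReal.ofReal (B * L) := by
  calc ∫⁻ x in Ico a (a + L), ENNReal.ofReal (f x)
      ≤ ∫⁻ _ in Ico a (a + L), ENNReal.ofReal B :=
        setLIntegral_mono' measurableSet_Ico fun x hx => ENNReal.ofReal_le_ofReal (h x hx)
    _ = ENNReal.ofReal (B * L) := by
        rw [setLIntegral_const, Real.volume_Ico, add_sub_cancel_left, ENNReal.ofReal_mul hB]

lemma le_setLIntegral_ofReal {f : ℝ → ℝ} {s : Set ℝ} {a L B : ℝ} (hB : 0 ≤ B)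
    (hs : Ico a (a + L) ⊆ s) (h : ∀ x ∈ Ico a (a + L), B ≤ f x) :
    ENNReal.ofReal (B * L) ≤ ∫⁻ x in s, ENNReal.ofReal (f x) := by
  calc ENNReal.ofReal (B * L) = ∫⁻ _ in Ico a (a + L), ENNReal.ofReal B := by
        rw [setLIntegral_const, Real.volume_Ico, add_sub_cancel_left, ENNReal.ofReal_mul hB]
    _ ≤ ∫⁻ x in Ico a (a + L), ENNReal.ofReal (f x) :=
        setLIntegral_mono' measurableSet_Ico fun x hx => ENNReal.ofReal_le_ofReal (h x hx)
    _ ≤ _ := lintegral_mono_set hs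

lemma setLIntegral_inv_sqrt {q τ : ℝ} (hτ : 0 ≤ τ) :
    ∫⁻ x in Ioc q (q + τ), ENNReal.ofReal (√(x - q))⁻¹ = ENNReal.ofReal (2 * √τ) := by
  have hle : q ≤ q + τ := by linarith
  have hcont : ContinuousOn (fun x : ℝ => 2 * √(x - q)) (Icc q (q + τ)) := by fun_prop
  have hderiv : ∀ x ∈ Ioo q (q + τ),
      HasDerivAt (fun x : ℝ => 2 * √(x - q)) (√(x - q))⁻¹ x := by
    intro x hx
    have h0 : x - q ≠ 0 := by linarith [hx.1]
    exact ((((hasDerivAt_id' x).sub_const q).sqrt h0).const_mul 2).congr_deriv (by field_simp)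
  have hint : IntegrableOn (fun x : ℝ => (√(x - q))⁻¹) (Ioc q (q + τ)) :=
    intervalIntegral.integrableOn_deriv_of_nonneg hcont hderiv fun x _ => by positivity
  rw [← ofReal_integral_eq_lintegral_ofReal hint (ae_of_all _ fun x => by positivity),
    ← intervalIntegral.integral_of_le hle,
    intervalIntegral.integral_eq_sub_of_hasDerivAt_of_le hle hcont hderiv
      ((intervalIntegrable_iff_integrableOn_Ioc_of_le hle).2 hint)]
  simp

/-- The weight `√(dip δ R (x - q))` gives comparable masses to intervals of the same length at
comparable distance from each other, to the right of `q`, uniformly in `δ` and `R`. Far away from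
`q` the weight is nearly constant on both intervals; near `q` it lies between constant multiples of
`(x - q) ^ (1 / 2)` and `(x - q) ^ (-1 / 2)`. -/
lemma setLIntegral_sqrt_dip_le {δ R q K L u v : ℝ} (hδ : 0 < δ) (hR : 0 < R) (hK : 0 ≤ K)
    (hL : 0 < L) (hu : q ≤ u) (hv : q ≤ v) (huv : |u - v| ≤ K * L) :
    ∫⁻ x in Ico u (u + L), ENNReal.ofReal √(dip δ R (x - q)) ≤
      ENNReal.ofReal (288 * (K + 1) ^ 2) *
        ∫⁻ x in Ico v (v + L), ENNReal.ofReal √(dip δ R (x - q)) := by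
  obtain ⟨huv1, huv2⟩ := abs_le.1 huv
  have hKL : 0 ≤ K * L := by positivity
  have hC : (0 : ℝ) ≤ 288 * (K + 1) ^ 2 := by positivity
  rcases le_or_gt (4 * (K + 1) * L) (v - q) with hfar | hnear
  · set H := dip δ R (v - q) with hH
    have hHpos : 0 < H := dip_pos hδ _ _
    have hKL1 : 0 < (K + 1) * L := by positivity
    have hvq : 0 < v - q := by nlinarith
    have key : ∀ x, |x - v| ≤ (K + 1) * L →
        dip δ R (x - q) ≤ 2 * H ∧ H / 2 ≤ dip δ R (x - q) := by
      intro x hx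
      obtain ⟨h1, h2⟩ := abs_le.1 hx
      have hx0 : 0 < x - q := by nlinarith
      have hp := dip_pos hδ R (x - q)
      rcases le_total (x - q) (v - q) with hxv | hxv
      · have h3 := mul_dip_le_mul_dip hδ hR hx0 hxv
        have h4 := dip_mul_le_dip_mul (R := R) hδ hx0 hxv
        rw [← hH] at h3 h4
        constructor <;> by_contra! hcon <;> nlinarith
      · have h3 := mul_dip_le_mul_dip hδ hR hvq hxv
        have h4 := dip_mul_le_dip_mul (R := R) hδ hvq hxv
        rw [← hH] at h3 h4
        constructor <;> by_contra! hcon <;> nlinarith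
    calc ∫⁻ x in Ico u (u + L), ENNReal.ofReal √(dip δ R (x - q))
        ≤ ENNReal.ofReal (√(2 * H) * L) := by
          refine setLIntegral_ofReal_le (by positivity) fun x hx => Real.sqrt_le_sqrt ?_
          exact (key x (abs_le.2 ⟨by linarith [hx.1], by linarith [hx.2]⟩)).1
      _ ≤ ENNReal.ofReal (288 * (K + 1) ^ 2 * (√(H / 2) * L)) := by
          apply ENNReal.ofReal_le_ofReal
          have h1 : √(2 * H) = 2 * √(H / 2) := by
            rw [show 2 * H = 2 ^ 2 * (H / 2) by ring, Real.sqrt_mul (by positivity),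
              Real.sqrt_sq (by norm_num)]
          rw [h1]
          have h2 : 0 ≤ √(H / 2) * L := by positivity
          nlinarith [mul_nonneg h2 hK, mul_nonneg h2 (sq_nonneg K)]
      _ = ENNReal.ofReal (288 * (K + 1) ^ 2) * ENNReal.ofReal (√(H / 2) * L) :=
          ENNReal.ofReal_mul hC
      _ ≤ _ := by
          gcongr
          refine le_setLIntegral_ofReal (by positivity) subset_rfl fun x hx =>
            Real.sqrt_le_sqrt ?_
          exact (key x (abs_le.2 ⟨by linarith [hx.1], by linarith [hx.2]⟩)).2
  · set τ := 6 * (K + 1) * L with hτ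
    have hτ0 : 0 < τ := by positivity
    set H := dip δ R τ with hH
    have hHpos : 0 < H := dip_pos hδ _ _
    set A := 12 * (K + 1) with hA
    have hA1 : 1 ≤ A := by linarith
    calc ∫⁻ x in Ico u (u + L), ENNReal.ofReal √(dip δ R (x - q))
        = ∫⁻ x in Ioo u (u + L), ENNReal.ofReal √(dip δ R (x - q)) :=
          (setLIntegral_congr Ioo_ae_eq_Ico).symm
      _ ≤ ∫⁻ x in Ioo u (u + L), ENNReal.ofReal √(τ * H) * ENNReal.ofReal (√(x - q))⁻¹ := by
          refine setLIntegral_mono' measurableSet_Ioo fun x hx => ?_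
          rw [← ENNReal.ofReal_mul (by positivity), ← Real.sqrt_inv,
            ← Real.sqrt_mul (by positivity)]
          have hx0 : 0 < x - q := by linarith [hx.1]
          have h1 := mul_dip_le_mul_dip hδ hR hx0
            (show x - q ≤ τ by rw [hτ]; nlinarith [hx.2])
          refine ENNReal.ofReal_le_ofReal (Real.sqrt_le_sqrt ?_)
          rw [← div_eq_mul_inv, le_div_iff₀ hx0]
          linarith
      _ = ENNReal.ofReal √(τ * H) * ∫⁻ x in Ioo u (u + L), ENNReal.ofReal (√(x - q))⁻¹ :=
          lintegral_const_mul' _ _ ENNReal.ofReal_ne_top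
      _ ≤ ENNReal.ofReal √(τ * H) * ∫⁻ x in Ioc q (q + τ), ENNReal.ofReal (√(x - q))⁻¹ := by
          gcongr
          intro x hx
          exact ⟨by linarith [hx.1], by rw [hτ]; nlinarith [hx.2]⟩
      _ = ENNReal.ofReal (2 * τ * √H) := by
          rw [setLIntegral_inv_sqrt hτ0.le, ← ENNReal.ofReal_mul (by positivity),
            Real.sqrt_mul hτ0.le]
          congr 1
          calc √τ * √H * (2 * √τ) = 2 * (√τ * √τ) * √H := by ring
            _ = 2 * τ * √H := by rw [Real.mul_self_sqrt hτ0.le]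
      _ ≤ ENNReal.ofReal (288 * (K + 1) ^ 2 * (√(H / A) * (L / 2))) := by
          apply ENNReal.ofReal_le_ofReal
          have h1 : √H ≤ A * √(H / A) := by
            have h2 : √A ≤ A := by
              rw [Real.sqrt_le_left (by linarith)]
              nlinarith
            have h3 : √H = √A * √(H / A) := by
              rw [← Real.sqrt_mul (by linarith)]
              congr 1
              field_simp
            rw [h3]
            gcongr
          calc 2 * τ * √H ≤ 2 * τ * (A * √(H / A)) := by gcongr
            _ = 288 * (K + 1) ^ 2 * (√(H / A) * (L / 2)) := by rw [hτ, hA]; ring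
      _ = ENNReal.ofReal (288 * (K + 1) ^ 2) * ENNReal.ofReal (√(H / A) * (L / 2)) :=
          ENNReal.ofReal_mul hC
      _ ≤ _ := by
          gcongr
          refine le_setLIntegral_ofReal (a := v + L / 2) (by positivity)
            (Ico_subset_Ico (by linarith) (by linarith)) fun x hx => Real.sqrt_le_sqrt ?_
          have hx0 : L / 2 ≤ x - q := by linarith [hx.1]
          have h1 := dip_mul_le_dip_mul (R := R) hδ (show 0 < x - q by linarith)
            (show x - q ≤ τ by rw [hτ]; nlinarith [hx.2])
          rw [← hH] at h1
          have h2 : H * (L / 2) ≤ dip δ R (x - q) * τ :=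
            (mul_le_mul_of_nonneg_left hx0 hHpos.le).trans h1
          rw [div_le_iff₀ (by linarith)]
          have h3 : τ = A * (L / 2) := by rw [hτ, hA]; ring
          rw [h3] at h2
          nlinarith

/-- A dip of outer scale `R` leaves a fixed proportion of the mass of every interval of length at
least `R`. -/
lemma le_setLIntegral_sqrt_dip {δ R q L u : ℝ} (hδ : 0 < δ) (hR : 0 < R) (hRL : R ≤ L) :
    ENNReal.ofReal (L / 8) ≤ ∫⁻ x in Ico u (u + L), ENNReal.ofReal √(dip δ R (x - q)) := by
  have hL : 0 < L := hR.trans_le hRL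
  rcases le_total (u + L / 2) q with h | h
  · refine (ENNReal.ofReal_le_ofReal (show L / 8 ≤ 1 * (L / 2) by linarith)).trans ?_
    refine le_setLIntegral_ofReal (a := u) zero_le_one
      (Ico_subset_Ico le_rfl (by linarith)) fun x hx => ?_
    rw [dip_eq_one hδ (by linarith [hx.2]), Real.sqrt_one]
  · rw [show L / 8 = 1 / 2 * (L / 4) by ring]
    refine le_setLIntegral_ofReal (a := u + 3 * L / 4) (by norm_num)
      (Ico_subset_Ico (by linarith) (by linarith)) fun x hx => ?_
    refine Real.le_sqrt_of_sq_le (le_trans (le_min (by norm_num) ?_) (min_one_div_le_dip δ R _))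
    rw [le_div_iff₀ hR]
    linarith [hx.1]

/-! ### Measures with one dip in each unit interval -/

/-- The density that on `[I, I + 1)`, `I : ℤ`, is the square root of a dip of scales `δ I` and
`R I` that starts at `q I`. -/
noncomputable def dipDensity (δ R q : ℤ → ℝ) (x : ℝ) : ℝ :=
  √(dip (δ ⌊x⌋) (R ⌊x⌋) (x - q ⌊x⌋))

/-- The measure with density `dipDensity δ R q` with respect to Lebesgue measure. -/
noncomputable def dipMeasure (δ R q : ℤ → ℝ) : Measure ℝ :=
  volume.withDensity fun x => ENNReal.ofReal (dipDensity δ R q x)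

lemma measurable_dipDensity (δ R q : ℤ → ℝ) : Measurable (dipDensity δ R q) := by
  have h (f : ℤ → ℝ) : Measurable fun x : ℝ => f ⌊x⌋ :=
    (measurable_of_countable f).comp Int.measurable_floor
  unfold dipDensity dip
  have h1 := h δ
  have h2 := h R
  have h3 := h q
  fun_prop

lemma dipMeasure_apply {δ R q : ℤ → ℝ} {s : Set ℝ} (hs : MeasurableSet s) :
    dipMeasure δ R q s = ∫⁻ x in s, ENNReal.ofReal (dipDensity δ R q x) :=
  withDensity_apply _ hs

lemma dipDensity_eq {δ R q : ℤ → ℝ} {I : ℤ} {x : ℝ} (hx : x ∈ Ico (I : ℝ) (I + 1)) :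
    dipDensity δ R q x = √(dip (δ I) (R I) (x - q I)) := by
  rw [dipDensity, Int.floor_eq_iff.2 hx]

lemma dipMeasure_apply_of_subset {δ R q : ℤ → ℝ} {I : ℤ} {s : Set ℝ} (hs : MeasurableSet s)
    (h : s ⊆ Ico (I : ℝ) (I + 1)) :
    dipMeasure δ R q s = ∫⁻ x in s, ENNReal.ofReal √(dip (δ I) (R I) (x - q I)) := by
  rw [dipMeasure_apply hs]
  exact setLIntegral_congr_fun hs fun x hx => by rw [dipDensity_eq (h hx)]

lemma dipDensity_le_one (δ R q : ℤ → ℝ) (x : ℝ) : dipDensity δ R q x ≤ 1 :=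
  Real.sqrt_le_one.2 (dip_le_one _ _ _)

lemma dipMeasure_Ico_le (δ R q : ℤ → ℝ) (a L : ℝ) :
    dipMeasure δ R q (Ico a (a + L)) ≤ ENNReal.ofReal L := by
  rw [dipMeasure_apply measurableSet_Ico]
  simpa using setLIntegral_ofReal_le (a := a) (L := L) zero_le_one
    fun x _ => dipDensity_le_one δ R q x

lemma dipMeasure_Ioo_pos_and_lt_top {δ : ℤ → ℝ} (hδ : ∀ I, 0 < δ I) (R q : ℤ → ℝ) {a b : ℝ}
    (hab : a < b) :
    0 < dipMeasure δ R q (Ioo a b) ∧ dipMeasure δ R q (Ioo a b) < ⊤ := by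
  constructor
  · have hac : volume ≪ dipMeasure δ R q :=
      withDensity_absolutelyContinuous' (measurable_dipDensity δ R q).ennreal_ofReal.aemeasurable
        (ae_of_all _ fun x => by
          simpa [dipDensity] using Real.sqrt_pos.2 (dip_pos (hδ _) _ _))
    refine pos_iff_ne_zero.2 fun h => ?_
    have := hac h
    simp only [Real.volume_Ioo, ENNReal.ofReal_eq_zero] at this
    linarith
  · have h := dipMeasure_Ico_le δ R q a (b - a)
    rw [add_sub_cancel] at h
    exact (measure_mono Ioo_subset_Ico_self).trans_lt (h.trans_lt ENNReal.ofReal_lt_top)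

/-- Intervals with integer endpoints keep a fixed proportion of their length. -/
lemma le_dipMeasure_Ico_intCast {δ R q : ℤ → ℝ} (hδ : ∀ I, 0 < δ I) (hR : ∀ I, 0 < R I)
    (hR1 : ∀ I, R I ≤ 1) (A : ℤ) (M : ℕ) :
    ENNReal.ofReal (M / 8) ≤ dipMeasure δ R q (Ico (A : ℝ) (A + M)) := by
  induction M with
  | zero => simp
  | succ M ih =>
    have hunit : ENNReal.ofReal (1 / 8) ≤
        dipMeasure δ R q (Ico ((A + M : ℤ) : ℝ) ((A + M : ℤ) + 1)) := by
      rw [dipMeasure_apply_of_subset measurableSet_Ico subset_rfl]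
      exact le_setLIntegral_sqrt_dip (hδ _) (hR _) (hR1 _)
    push_cast at hunit ⊢
    rw [← add_assoc, ← Ico_union_Ico_eq_Ico (b := (A : ℝ) + M) (by simp) (by simp),
      measure_union (by simp) measurableSet_Ico, add_div,
      ENNReal.ofReal_add (by positivity) (by positivity)]
    exact add_le_add ih hunit

/-! ### Adic doubling -/

/-- A point of the grid `N ^ (-i) * ℤ` is not interior to an `N`-adic interval of generation
`j ≥ i`. -/
lemma add_one_div_zpow_le {N : ℕ} (hN : 0 < N) {i : ℕ} {j : ℤ} (hij : (i : ℤ) ≤ j) {k z : ℤ}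
    (h : (k : ℝ) / (N : ℝ) ^ j < z / (N : ℝ) ^ i) :
    ((k : ℝ) + 1) / (N : ℝ) ^ j ≤ z / (N : ℝ) ^ i := by
  obtain ⟨d, rfl⟩ := Int.le.dest hij
  have hN' : (0 : ℝ) < N := by exact_mod_cast hN
  have e : (z : ℝ) / (N : ℝ) ^ i = (z * N ^ d : ℤ) / (N : ℝ) ^ ((i : ℤ) + d) := by
    rw [zpow_add₀ hN'.ne', zpow_natCast, zpow_natCast]
    push_cast
    field_simp
  rw [e] at h ⊢
  have hp : (0 : ℝ) < (N : ℝ) ^ ((i : ℤ) + d) := by positivity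
  rw [div_lt_div_iff_of_pos_right hp] at h
  rw [div_le_div_iff_of_pos_right hp]
  exact_mod_cast h

/-- If the `I`-th dip starts within `δ I` of a point `z / N ^ i` whose generation satisfies
`R I ≤ N ^ (-i)`, the `N`-adic grid does not detect it: intervals of length less than
`N ^ (-i)` lie on one side of `z / N ^ i`, and longer ones only see the average of the dip. -/
lemma isNadicDoubling_dipMeasure {N : ℕ} (hN : 2 ≤ N) {δ R q : ℤ → ℝ} (hδ : ∀ I, 0 < δ I)
    (hR : ∀ I, 0 < R I) (hR1 : ∀ I, R I ≤ 1)
    (hgrid : ∀ I, ∃ (i : ℕ) (z : ℤ), q I ≤ z / (N : ℝ) ^ i ∧ z / (N : ℝ) ^ i ≤ q I + δ I ∧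
      R I ≤ ((N : ℝ) ^ i)⁻¹) :
    IsNadicDoubling N (dipMeasure δ R q) := by
  have hN0 : 0 < N := by lia
  have hNR : (0 : ℝ) < N := by exact_mod_cast hN0
  have hN1 : (1 : ℝ) ≤ N := by exact_mod_cast hN0
  set μ := dipMeasure δ R q
  refine ⟨(288 * ((N : ℝ) + 1) ^ 2).toNNReal, fun j k i i' => ?_⟩
  change _ ≤ ENNReal.ofReal (288 * ((N : ℝ) + 1) ^ 2) * _
  have hC : (8 : ℝ) ≤ 288 * ((N : ℝ) + 1) ^ 2 := by nlinarith
  set L : ℝ := ((N : ℝ) ^ (j + 1))⁻¹ with hL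
  have hLpos : 0 < L := by positivity
  have hform (K : ℤ) : nadicInterval N (j + 1) K = Ico (K * L) (K * L + L) := by
    rw [nadicInterval, div_eq_mul_inv, div_eq_mul_inv, add_mul, one_mul]
  have hparent : (N : ℝ) * L = ((N : ℝ) ^ j)⁻¹ := by
    rw [hL, zpow_add_one₀ hNR.ne']
    field_simp
  -- A lower bound for the mass in terms of the length suffices.
  have of_lower (a a' : ℝ) (h : ENNReal.ofReal (L / 8) ≤ μ (Ico a' (a' + L))) :
      μ (Ico a (a + L)) ≤ ENNReal.ofReal (288 * ((N : ℝ) + 1) ^ 2) * μ (Ico a' (a' + L)) := by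
    calc μ (Ico a (a + L)) ≤ ENNReal.ofReal L := dipMeasure_Ico_le _ _ _ _ _
      _ = ENNReal.ofReal 8 * ENNReal.ofReal (L / 8) := by
          rw [← ENNReal.ofReal_mul (by norm_num)]
          congr 1
          ring
      _ ≤ _ := by gcongr
  rw [hform, hform]
  rcases lt_or_ge j 0 with hj | hj
  · refine of_lower _ _ ?_
    obtain ⟨d, hd⟩ : ∃ d : ℕ, j + 1 = -(d : ℤ) := ⟨(-(j + 1)).toNat, by lia⟩
    have hLd : L = ((N ^ d : ℕ) : ℝ) := by
      rw [hL, hd, zpow_neg, inv_inv, zpow_natCast]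
      push_cast
      rfl
    rw [hLd]
    have := le_dipMeasure_Ico_intCast (q := q) hδ hR hR1
      (((N : ℤ) * k + ((i' : ℕ) : ℤ)) * (N ^ d : ℕ)) (N ^ d)
    push_cast at this ⊢
    exact this
  · set P : ℝ := (k : ℝ) / (N : ℝ) ^ j with hP
    have hPL : P = k * (N * L) := by rw [hP, hparent, div_eq_mul_inv]
    have hQL : ((k : ℝ) + 1) / (N : ℝ) ^ j = P + N * L := by
      rw [hPL, hparent, div_eq_mul_inv, add_mul, one_mul]
    have hchild (c : Fin N) : P ≤ (((N : ℤ) * k + ((c : ℕ) : ℤ) : ℤ) : ℝ) * L ∧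
        (((N : ℤ) * k + ((c : ℕ) : ℤ) : ℤ) : ℝ) * L + L ≤ P + N * L := by
      have hc : ((c : ℕ) : ℝ) + 1 ≤ N := by exact_mod_cast c.isLt
      have e : (((N : ℤ) * k + ((c : ℕ) : ℤ) : ℤ) : ℝ) * L = P + (c : ℕ) * L := by
        rw [hPL]
        push_cast
        ring
      rw [e]
      exact ⟨le_add_of_nonneg_right (by positivity), by nlinarith⟩
    obtain ⟨h1, h2⟩ := hchild i
    obtain ⟨h1', h2'⟩ := hchild i'
    set a : ℝ := (((N : ℤ) * k + ((i : ℕ) : ℤ) : ℤ) : ℝ) * L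
    set a' : ℝ := (((N : ℤ) * k + ((i' : ℕ) : ℤ) : ℤ) : ℝ) * L
    -- The parent lies in the unit interval `[I, I + 1)`.
    set I : ℤ := ⌊P⌋ with hI
    have hI1 : (I : ℝ) ≤ P := Int.floor_le P
    have hI2 : P + N * L ≤ (I : ℝ) + 1 := by
      have h := add_one_div_zpow_le (i := 0) hN0 (by simpa using hj) (k := k) (z := I + 1)
        (by
          rw [← hP, pow_zero, div_one]
          push_cast
          exact Int.lt_floor_add_one P)
      rw [hQL] at h
      simpa using h
    have hsub : Ico a (a + L) ⊆ Ico (I : ℝ) (I + 1) :=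
      Ico_subset_Ico (hI1.trans h1) (h2.trans hI2)
    have hsub' : Ico a' (a' + L) ⊆ Ico (I : ℝ) (I + 1) :=
      Ico_subset_Ico (hI1.trans h1') (h2'.trans hI2)
    obtain ⟨g, z, hz1, hz2, hz3⟩ := hgrid I
    rcases le_or_gt (g : ℤ) j with hgj | hgj
    · rcases lt_or_ge P (z / (N : ℝ) ^ g) with hPz | hPz
      · refine of_lower _ _ ?_
        have h3 := add_one_div_zpow_le hN0 hgj hPz
        rw [hQL] at h3
        rw [dipMeasure_apply_of_subset measurableSet_Ico hsub']
        refine (ENNReal.ofReal_le_ofReal (show L / 8 ≤ 1 * L by linarith)).trans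
          (le_setLIntegral_ofReal zero_le_one subset_rfl fun x hx => ?_)
        rw [dip_eq_one (hδ I) (by linarith [hx.2]), Real.sqrt_one]
      · rw [dipMeasure_apply_of_subset measurableSet_Ico hsub,
          dipMeasure_apply_of_subset measurableSet_Ico hsub']
        exact setLIntegral_sqrt_dip_le (hδ I) (hR I) hNR.le hLpos (by linarith) (by linarith)
          (abs_le.2 ⟨by linarith, by linarith⟩)
    · refine of_lower _ _ ?_
      rw [dipMeasure_apply_of_subset measurableSet_Ico hsub']
      refine le_setLIntegral_sqrt_dip (hδ I) (hR I) (hz3.trans ?_)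
      rw [hL, ← zpow_natCast]
      have : (N : ℝ) ^ (j + 1) ≤ (N : ℝ) ^ (g : ℤ) := zpow_le_zpow_right₀ hN1 (by lia)
      gcongr

/-! ### Failure of doubling -/

/-- If the ratios `δ I / R I` are arbitrarily small along dips that stay away from the integers,
the doubling condition fails: for small `ε`, the dip is at most `√ε` on most of
`(q I, q I + ε * R I)`, while the density is `1` to the left of `q I`. -/
lemma not_isDoublingOn_dipMeasure {δ R q : ℤ → ℝ} (hδ : ∀ I, 0 < δ I) (hR : ∀ I, 0 < R I)
    (h : ∀ ε > 0, ∃ I : ℤ, δ I ≤ ε * R I ∧ I + R I ≤ q I ∧ q I + R I ≤ I + 1) :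
    ¬ IsDoublingOn (dipMeasure δ R q) (Set.range ((↑) : ℤ → ℝ))ᶜ := by
  rintro ⟨C, hC⟩
  set η : ℝ := 1 / (8 * C + 5) with hη
  have hC0 : (0 : ℝ) ≤ C := C.2
  have hη0 : 0 < η := by positivity
  have hηC : η * (8 * C + 5) = 1 := by rw [hη]; field_simp
  have hη1 : η ≤ 1 / 5 := by nlinarith
  set ε : ℝ := η ^ 2 with hε
  have hε0 : 0 < ε := by positivity
  have hεη : ε ≤ η := by nlinarith
  obtain ⟨I, hI1, hI2, hI3⟩ := h (ε ^ 3) (by positivity)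
  have hRI := hR I
  have hδI := hδ I
  set d := δ I
  set Q := q I
  set ρ := R I
  set r : ℝ := ε * ρ / 2 with hr
  have hr0 : 0 < r := by positivity
  have hrρ : 3 * r ≤ ρ := by rw [hr]; nlinarith
  have hdε : d / ε ≤ 2 * r * η := by
    rw [div_le_iff₀ hε0]
    calc d ≤ ε ^ 3 * ρ := hI1
      _ = ε * ρ * ε * ε := by ring
      _ ≤ ε * ρ * η * ε := by gcongr
      _ = _ := by rw [hr]; ring
  have hbig : ENNReal.ofReal (r / 2) ≤ dipMeasure δ R q (Metric.ball (Q + r) (2 * r)) := by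
    rw [Real.ball_eq_Ioo, dipMeasure_apply_of_subset (I := I) measurableSet_Ioo]
    · rw [← one_mul (r / 2)]
      refine le_setLIntegral_ofReal (a := Q - r / 2) zero_le_one ?_ fun x hx => ?_
      · exact fun x hx => ⟨by linarith [hx.1], by linarith [hx.2]⟩
      · rw [dip_eq_one hδI (by linarith [hx.2]), Real.sqrt_one]
    · intro x hx
      exact ⟨by linarith [hx.1], by linarith [hx.2]⟩
  have hsmall : dipMeasure δ R q (Metric.ball (Q + r) r) ≤ ENNReal.ofReal (4 * r * η) := by
    have hsub : Ioo (Q + r - r) (Q + r + r) ⊆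
        Ico Q (Q + d / ε) ∪ Ico (Q + d / ε) (Q + d / ε + (2 * r - d / ε)) := by
      intro x hx
      rcases lt_or_ge x (Q + d / ε) with h | h
      · exact Or.inl ⟨by linarith [hx.1], h⟩
      · exact Or.inr ⟨h, by linarith [hx.2]⟩
    rw [Real.ball_eq_Ioo]
    refine (measure_mono hsub).trans ((measure_union_le _ _).trans ?_)
    calc _ ≤ ENNReal.ofReal (2 * r * η) + ENNReal.ofReal (2 * r * η) := by
          refine add_le_add ((dipMeasure_Ico_le _ _ _ _ _).trans
            (ENNReal.ofReal_le_ofReal hdε)) ?_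
          have hd0 : 0 < d / ε := by positivity
          rw [dipMeasure_apply_of_subset (I := I) measurableSet_Ico
            (Ico_subset_Ico (by linarith) (by linarith))]
          refine (setLIntegral_ofReal_le hη0.le fun x hx => ?_).trans
            (ENNReal.ofReal_le_ofReal (show η * (2 * r - d / ε) ≤ 2 * r * η by nlinarith))
          refine (Real.sqrt_le_left hη0.le).2 ((min_le_right _ _).trans (max_le ?_ ?_))
          · rw [div_le_iff₀ hRI]
            linarith [hx.2, hr, hε]
          · have ht : d / ε ≤ x - Q := by linarith [hx.1]
            rw [div_le_iff₀ (lt_max_of_lt_right hδI), ← hε]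
            rw [div_le_iff₀ hε0] at ht
            nlinarith [le_max_left (x - Q) d]
      _ = _ := by
          rw [← ENNReal.ofReal_add (by positivity) (by positivity)]
          congr 1
          ring
  have hball : Metric.ball (Q + r) (2 * r) ⊆ (Set.range ((↑) : ℤ → ℝ))ᶜ := by
    rintro x hx ⟨z, rfl⟩
    rw [Real.ball_eq_Ioo] at hx
    have hz1 : (I : ℝ) < z := by linarith [hx.1]
    have hz2 : (z : ℝ) < I + 1 := by linarith [hx.2]
    norm_cast at hz1 hz2
    lia
  have hcomp := hbig.trans ((hC _ _ hr0 hball).trans (mul_le_mul_right hsmall _))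
  rw [← ENNReal.ofReal_coe_nnreal, ← ENNReal.ofReal_mul hC0,
    ENNReal.ofReal_le_ofReal_iff (by positivity)] at hcomp
  nlinarith

/-! ### Dips at adic points -/

lemma dip_self (δ t : ℝ) (hδ : 0 < δ) : dip δ δ t = 1 := by
  rcases le_total t δ with h | h
  · exact dip_eq_one hδ h
  · exact min_eq_left (le_max_of_le_left ((one_le_div hδ).2 h))

/-- The `I`-th dip is strictly below `1` between its two scales. -/
lemma dipMeasure_Ioo_lt {δ R q : ℤ → ℝ} {I : ℤ} (hδ : 0 < δ I) (hδR : δ I < R I)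
    (h1 : I ≤ q I) (h2 : q I + R I ≤ I + 1) :
    dipMeasure δ R q (Ioo (q I + δ I) (q I + R I)) < ENNReal.ofReal (R I - δ I) := by
  have hvol : volume (Ioo (q I + δ I) (q I + R I)) = ENNReal.ofReal (R I - δ I) := by
    rw [Real.volume_Ioo, add_sub_add_left_eq_sub]
  have hne : volume (Ioo (q I + δ I) (q I + R I)) ≠ 0 := by
    rw [hvol]
    exact (ENNReal.ofReal_pos.2 (sub_pos.2 hδR)).ne'
  rw [← hvol, dipMeasure_apply_of_subset (I := I) measurableSet_Ioo
    fun x hx => ⟨by linarith [hx.1], by linarith [hx.2]⟩, ← setLIntegral_one]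
  refine setLIntegral_strict_mono measurableSet_Ioo hne measurable_const ?_ ?_
  · refine ne_top_of_le_ne_top (b := volume (Ioo (q I + δ I) (q I + R I))) (by simp) ?_
    rw [← setLIntegral_one]
    exact lintegral_mono fun x =>
      ENNReal.ofReal_le_one.2 (Real.sqrt_le_one.2 (dip_le_one _ _ _))
  · refine ae_of_all _ fun x hx => ENNReal.ofReal_lt_one.2 ?_
    rw [Real.sqrt_lt' one_pos, one_pow]
    have hR : 0 < R I := hδ.trans hδR
    refine min_lt_of_right_lt (max_lt ((div_lt_one hR).2 (by linarith [hx.2])) ?_)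
    exact (div_lt_one (lt_max_of_lt_right hδ)).2 (lt_max_of_lt_left (by linarith [hx.1]))

/-- Coprime `m ^ i` and `n ^ i` have points `k / m ^ i` and `l / n ^ i` at the minimal distance
`(m * n) ^ (-i)`, the second one in `[0, 1)`. -/
lemma exists_mul_pow_sub_mul_pow_eq_one {m n : ℕ} (hn : 0 < n) (hmn : Nat.Coprime m n) (i : ℕ) :
    ∃ k l : ℤ, k * (n : ℤ) ^ i - l * (m : ℤ) ^ i = 1 ∧ 0 ≤ l ∧ l < (n : ℤ) ^ i := by
  have hcop : IsCoprime ((m : ℤ) ^ i) ((n : ℤ) ^ i) :=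
    IsCoprime.pow (Nat.isCoprime_iff_coprime.2 hmn)
  obtain ⟨u, v, huv⟩ := hcop
  have hpos : (0 : ℤ) < (n : ℤ) ^ i := by positivity
  refine ⟨v - (-u) / (n : ℤ) ^ i * (m : ℤ) ^ i, (-u) % (n : ℤ) ^ i, ?_,
    Int.emod_nonneg _ hpos.ne', Int.emod_lt_of_pos _ hpos⟩
  rw [Int.emod_def]
  linear_combination huv

/-- The measure whose dip in `[I, I + 1)` has generation `i = I - N`, outer scale `n ^ (-i)`, inner
scale `(m * n) ^ (-i)`, and starts at the point `I + l i / n ^ i`. For `I ≤ N` the truncated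
difference gives `i = 0`, and the density is `1` there. -/
noncomputable def adicDipMeasure (m n : ℕ) (l : ℕ → ℤ) (N : ℕ) : Measure ℝ :=
  dipMeasure (fun I => ((m : ℝ) ^ (I - N).toNat * (n : ℝ) ^ (I - N).toNat)⁻¹)
    (fun I => ((n : ℝ) ^ (I - N).toNat)⁻¹)
    (fun I => I + l (I - N).toNat / (n : ℝ) ^ (I - N).toNat)

lemma adicDipMeasure_apply_of_le {m n : ℕ} {l : ℕ → ℤ} {N : ℕ} {I : ℤ} (hI : I ≤ N) {s : Set ℝ}
    (hs : MeasurableSet s) (h : s ⊆ Ico (I : ℝ) (I + 1)) :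
    adicDipMeasure m n l N s = volume s := by
  have h0 : (I - N).toNat = 0 := by lia
  rw [adicDipMeasure, dipMeasure_apply_of_subset hs h]
  simp [h0, dip_self]

/-- The start of the dip of positive generation in `adicDipMeasure m n l N` is not an integer. -/
lemma one_le_of_mul_pow_sub_mul_pow_eq_one {m n : ℕ} (hn : 2 ≤ n) {i : ℕ} (hi : i ≠ 0) {k l : ℤ}
    (h : k * (n : ℤ) ^ i - l * (m : ℤ) ^ i = 1) (hl : 0 ≤ l) : 1 ≤ l := by
  by_contra! hlt
  obtain rfl : l = 0 := by lia
  have h1 : (n : ℤ) ^ i ∣ 1 := ⟨k, by linarith⟩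
  have h2 : n ^ i ∣ 1 := by exact_mod_cast h1
  have h3 : 1 < n ^ i := Nat.one_lt_pow hi (by lia)
  exact h3.ne' (Nat.dvd_one.1 h2)

section AdicDip

variable {m n : ℕ} {k l : ℕ → ℤ}

lemma eq_of_adicDipMeasure_eq_smul (hm : 2 ≤ m) (hn : 2 ≤ n)
    (hl0 : ∀ i, 0 ≤ l i) (hln : ∀ i, l i < (n : ℤ) ^ i) {N₁ N₂ : ℕ} {c : ℝ≥0}
    (h : adicDipMeasure m n l N₁ = c • adicDipMeasure m n l N₂) : N₁ = N₂ := by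
  have hsub : Ico (-1 : ℝ) 0 ⊆ Ico ((-1 : ℤ) : ℝ) ((-1 : ℤ) + 1) := by norm_num
  have hc : c = 1 := by
    have h1 : adicDipMeasure m n l N₁ (Ico (-1) 0) =
        (c • adicDipMeasure m n l N₂) (Ico (-1) 0) := by
      rw [h]
    rw [Measure.smul_apply, adicDipMeasure_apply_of_le (by lia) measurableSet_Ico hsub,
      adicDipMeasure_apply_of_le (by lia) measurableSet_Ico hsub] at h1
    simpa [ENNReal.smul_def] using h1.symm
  rw [hc, one_smul] at h
  -- The dip of generation `1` of the measure with the smaller parameter distinguishes the two.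
  have key : ∀ N₁ N₂ : ℕ, N₁ < N₂ → adicDipMeasure m n l N₁ ≠ adicDipMeasure m n l N₂ := by
    intro N₁ N₂ hlt heq
    have h1 : ((N₁ + 1 : ℤ) - N₁).toNat = 1 := by lia
    have hm' : (2 : ℝ) ≤ m := by exact_mod_cast hm
    have hn' : (2 : ℝ) ≤ n := by exact_mod_cast hn
    have hl0' : (0 : ℝ) ≤ l 1 := by exact_mod_cast hl0 1
    have hln' : (l 1 : ℝ) + 1 ≤ n := by
      have := hln 1
      rw [pow_one] at this
      exact_mod_cast this
    have hq : (l 1 : ℝ) / n + (n : ℝ)⁻¹ ≤ 1 := by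
      rw [inv_eq_one_div, ← add_div, div_le_one (by linarith)]
      exact hln'
    have hq0 : (0 : ℝ) ≤ (l 1 : ℝ) / n := by positivity
    have hδ : (0 : ℝ) < ((m : ℝ) * n)⁻¹ := by positivity
    have hδR : ((m : ℝ) * n)⁻¹ < (n : ℝ)⁻¹ := by
      gcongr
      nlinarith
    have hlt' := dipMeasure_Ioo_lt
      (δ := fun I => ((m : ℝ) ^ (I - N₁).toNat * (n : ℝ) ^ (I - N₁).toNat)⁻¹)
      (R := fun I => ((n : ℝ) ^ (I - N₁).toNat)⁻¹)
      (q := fun I => I + l (I - N₁).toNat / (n : ℝ) ^ (I - N₁).toNat) (I := N₁ + 1)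
      (by simpa only [h1, pow_one] using hδ) (by simpa only [h1, pow_one] using hδR)
      (by simpa only [h1, pow_one] using le_add_of_nonneg_right hq0)
      (by simp only [h1, pow_one]; linarith)
    rw [← adicDipMeasure, heq, adicDipMeasure_apply_of_le (I := N₁ + 1) (by lia)
      measurableSet_Ioo, Real.volume_Ioo, add_sub_add_left_eq_sub] at hlt'
    · exact lt_irrefl _ hlt'
    · simp only [h1, pow_one]
      intro x hx
      exact ⟨by linarith [hx.1], by linarith [hx.2]⟩
  rcases lt_trichotomy N₁ N₂ with h1 | h1 | h1
  · exact absurd h (key _ _ h1)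
  · exact h1
  · exact absurd h.symm (key _ _ h1)

lemma isNadicDoubling_left_adicDipMeasure (hm : 2 ≤ m) (hlt : m < n)
    (hkl : ∀ i, k i * (n : ℤ) ^ i - l i * (m : ℤ) ^ i = 1) (N : ℕ) :
    IsNadicDoubling m (adicDipMeasure m n l N) := by
  have hm' : (2 : ℝ) ≤ m := by exact_mod_cast hm
  have hlt' : (m : ℝ) < n := by exact_mod_cast hlt
  have hm0 : (0 : ℝ) < m := by linarith
  have hn0 : (0 : ℝ) < n := by linarith
  refine isNadicDoubling_dipMeasure hm (fun I => by positivity) (fun I => by positivity)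
    (fun I => inv_le_one_of_one_le₀ (one_le_pow₀ (by linarith))) fun I => ?_
  generalize (I - N).toNat = i
  have hkl' : (k i : ℝ) * (n : ℝ) ^ i - l i * (m : ℝ) ^ i = 1 := by exact_mod_cast hkl i
  have hp : ((I * (m : ℤ) ^ i + k i : ℤ) : ℝ) / (m : ℝ) ^ i =
      I + l i / (n : ℝ) ^ i + ((m : ℝ) ^ i * (n : ℝ) ^ i)⁻¹ := by
    push_cast
    field_simp
    linear_combination hkl'
  refine ⟨i, I * (m : ℤ) ^ i + k i, ?_, hp.le, ?_⟩
  · rw [hp]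
    exact le_add_of_nonneg_right (by positivity)
  · gcongr

lemma isNadicDoubling_right_adicDipMeasure (hm : 2 ≤ m) (hn : 2 ≤ n) (N : ℕ) :
    IsNadicDoubling n (adicDipMeasure m n l N) := by
  have hm' : (2 : ℝ) ≤ m := by exact_mod_cast hm
  have hn' : (2 : ℝ) ≤ n := by exact_mod_cast hn
  have hm0 : (0 : ℝ) < m := by linarith
  have hn0 : (0 : ℝ) < n := by linarith
  refine isNadicDoubling_dipMeasure hn (fun I => by positivity) (fun I => by positivity)
    (fun I => inv_le_one_of_one_le₀ (one_le_pow₀ (by linarith))) fun I => ?_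
  generalize (I - N).toNat = i
  have hp : ((I * (n : ℤ) ^ i + l i : ℤ) : ℝ) / (n : ℝ) ^ i = I + l i / (n : ℝ) ^ i := by
    push_cast
    field_simp
  refine ⟨i, I * (n : ℤ) ^ i + l i, hp.ge, ?_, le_rfl⟩
  rw [hp]
  exact le_add_of_nonneg_right (by positivity)

lemma not_isDoublingOn_adicDipMeasure (hm : 2 ≤ m) (hn : 2 ≤ n)
    (hkl : ∀ i, k i * (n : ℤ) ^ i - l i * (m : ℤ) ^ i = 1) (hl0 : ∀ i, 0 ≤ l i)
    (hln : ∀ i, l i < (n : ℤ) ^ i) (N : ℕ) :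
    ¬ IsDoublingOn (adicDipMeasure m n l N) (Set.range ((↑) : ℤ → ℝ))ᶜ := by
  have hm' : (2 : ℝ) ≤ m := by exact_mod_cast hm
  have hn' : (2 : ℝ) ≤ n := by exact_mod_cast hn
  have hm0 : (0 : ℝ) < m := by linarith
  have hn0 : (0 : ℝ) < n := by linarith
  refine not_isDoublingOn_dipMeasure (fun I => by positivity) (fun I => by positivity)
    fun ε hε => ?_
  obtain ⟨i, hi⟩ := exists_pow_lt_of_lt_one hε
    (inv_lt_one_of_one_lt₀ (show 1 < (m : ℝ) by linarith))
  have hgen : ((N + (i + 1 : ℕ) : ℤ) - N).toNat = i + 1 := by lia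
  refine ⟨N + (i + 1 : ℕ), ?_⟩
  simp only [hgen]
  have hl1 : (1 : ℝ) ≤ l (i + 1) := by
    exact_mod_cast one_le_of_mul_pow_sub_mul_pow_eq_one hn (Nat.succ_ne_zero i) (hkl _) (hl0 _)
  have hl2 : (l (i + 1) : ℝ) + 1 ≤ (n : ℝ) ^ (i + 1) := by exact_mod_cast hln (i + 1)
  have hnp : (0 : ℝ) < (n : ℝ) ^ (i + 1) := by positivity
  refine ⟨?_, ?_, ?_⟩
  · rw [mul_inv, ← inv_pow (m : ℝ)]
    gcongr
    refine le_trans ?_ hi.le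
    exact pow_le_pow_of_le_one (by positivity) (inv_le_one_of_one_le₀ (by linarith)) (by lia)
  · rw [inv_eq_one_div]
    gcongr
  · rw [inv_eq_one_div, add_assoc, ← add_div]
    gcongr
    exact (div_le_one hnp).2 hl2

end AdicDip

lemma IsDoublingOn.mono {μ : Measure ℝ} {s t : Set ℝ} (hst : s ⊆ t) (h : IsDoublingOn μ t) :
    IsDoublingOn μ s :=
  h.imp fun _ hC x r hr hs => hC x r hr (hs.trans hst)

theorem theorem1p1 (m n : ℕ) (hm : 2 ≤ m) (hn : 2 ≤ n) (hmn : Nat.Coprime m n) :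
    ∃ S : Set (Measure ℝ),
      S.Infinite ∧
      (∀ μ ∈ S, ∀ ν ∈ S, μ ≠ ν → ∀ c : ℝ≥0, ν ≠ c • μ) ∧
      ∀ μ ∈ S,
        (∀ a b : ℝ, a < b → 0 < μ (Set.Ioo a b) ∧ μ (Set.Ioo a b) < ⊤) ∧
        IsNadicDoubling m μ ∧
        IsNadicDoubling n μ ∧
        ¬ IsDoubling μ ∧
        ¬ IsDoublingOn μ (Set.range ((↑) : ℤ → ℝ))ᶜ := by
  wlog hlt : m < n generalizing m n
  · have hne : m ≠ n := by
      rintro rfl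
      rw [Nat.coprime_self] at hmn
      lia
    obtain ⟨S, h1, h2, h3⟩ := this n m hn hm hmn.symm (by lia)
    refine ⟨S, h1, h2, fun μ hμ => ?_⟩
    obtain ⟨ha, hb, hc, hd⟩ := h3 μ hμ
    exact ⟨ha, hc, hb, hd⟩
  choose k l hkl hl0 hln using
    exists_mul_pow_sub_mul_pow_eq_one (show 0 < n by lia) hmn
  have hinj := @eq_of_adicDipMeasure_eq_smul m n l hm hn hl0 hln
  refine ⟨Set.range (adicDipMeasure m n l), Set.infinite_range_of_injective fun N₁ N₂ h =>
    hinj (c := 1) (by rw [one_smul, h]), ?_, ?_⟩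
  · rintro _ ⟨N₁, rfl⟩ _ ⟨N₂, rfl⟩ hne c h
    exact hne (by rw [hinj h])
  · rintro _ ⟨N, rfl⟩
    have hnot := not_isDoublingOn_adicDipMeasure hm hn hkl hl0 hln N
    refine ⟨fun a b hab => dipMeasure_Ioo_pos_and_lt_top (fun I => ?_) _ _ hab,
      isNadicDoubling_left_adicDipMeasure hm hlt hkl N,
      isNadicDoubling_right_adicDipMeasure hm hn N,
      fun h => hnot (h.mono (subset_univ _)), hnot⟩
    have hm0 : 0 < m := by lia
    have hn0 : 0 < n := by lia
    positivity
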